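/- Let $K$ be a field. A weighted oriented graph $D$ on a finite vertex set $V(D)$ is a simple graph in which every edge is given exactly one direction, together with a weight function $w:V(D)\to\mathbb{N}\setminus\{0\}$; we write $(u,v)\in E(D)$ for an edge directed from $u$ to $v$. Its edge ideal is $$I(D)=\big\langle\, x_u x_v^{w(v)} \;:\; (u,v)\in E(D)\,\big\rangle\subseteq K[x_v : v\in V(D)],$$ and $D$ is called Cohen–Macaulay if the ring $K[x_v: v\in V(D)]/I(D)$ is Cohen–Macaulay. For $S\subseteq V(D)$ let $D\setminus S$ be the induced weighted oriented graph on $V(D)\setminus S$ (with the same directions and weights). Let $D_H$ be a weighted oriented graph with vertex set $\{x_1,\dots,x_n,z,y\}$ such that $z$ is adjacent to $y$, $\deg(y)=1$, $\deg(z)\ge 2$ and $w(z)=1$, where degrees are taken in the underlying simple graph. Label the vertices so that $x_1,\dots,x_k,y$ are exactly the vertices adjacent to $z$, and so that $(x_1,z),\dots,(x_s,z)\in E(D_H)$ and $(z,x_{s+1}),\dots,(z,x_k)\in E(D_H)$ for some $0\le s\le k$; the edge between $y$ and $z$ may have either direction. Put $$D_G=D_H\setminus\{z,y\},\qquad D_F=D_G\setminus\{x_1,\dots,x_k\}.$$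 If $D_H$ is Cohen–Macaulay, then $D_G$ is Cohen–Macaulay. If, moreover, for every $j$ with $s+1\le j\le k$ and every vertex $v$ of $D_F$ adjacent to $x_j$ one has $(v,x_j)\in E(D_G)$, then $D_F$ is Cohen–Macaulay as well. -/

import Mathlib

/-- The depth of a local ring `R`: the supremum of the lengths of the `R`-regular sequences
contained in the maximal ideal. -/
noncomputable def localRingDepth (R : Type*) [CommRing R] [IsLocalRing R] : ℕ∞ :=
  ⨆ rs : {rs : List R // (∀ r ∈ rs, r ∈ IsLocalRing.maximalIdeal R) ∧
    RingTheory.Sequence.IsRegular R rs}, (rs.1.length : ℕ∞)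

/-- A Cohen-Macaulay local ring: Noetherian, with depth equal to Krull dimension. -/
structure IsCohenMacaulayLocal (R : Type*) [CommRing R] [IsLocalRing R] : Prop where
  noetherian : IsNoetherianRing R
  depth_eq_dim : (localRingDepth R : WithBot ℕ∞) = ringKrullDim R

/-- A Cohen-Macaulay ring: Noetherian, and all localizations at maximal ideals are
Cohen-Macaulay local rings. -/
structure IsCohenMacaulay (R : Type*) [CommRing R] : Prop where
  noetherian : IsNoetherianRing R
  localization : ∀ (m : Ideal R) [m.IsMaximal], IsCohenMacaulayLocal (Localization.AtPrime m)

/-- A weighted oriented graph on the vertex set `V`. `Adj u v` says that `(u, v)` is an edge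
directed from `u` to `v`. By asymmetry there are no loops and every edge of the underlying
simple graph carries exactly one direction. The weights are positive integers. -/
structure WeightedOrientedGraph (V : Type*) extends Digraph V where
  asymm : ∀ u v, Adj u v → ¬ Adj v u
  weight : V → ℕ
  weight_pos : ∀ v, 0 < weight v

namespace WeightedOrientedGraph

variable {V : Type*}

/-- The underlying simple graph. -/
def underlying (D : WeightedOrientedGraph V) : SimpleGraph V :=
  D.toDigraph.toSimpleGraphInclusive

/-- The set of vertices adjacent to `v` (in either direction). -/
def neighbors (D : WeightedOrientedGraph V) (v : V) : Set V :=
  D.underlying.neighborSet v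

/-- The degree of `v` in the underlying simple graph (used for finite `V`). -/
noncomputable def degree (D : WeightedOrientedGraph V) (v : V) : ℕ :=
  (D.neighbors v).ncard

/-- The induced weighted oriented graph `D \ S` on the vertices outside `S`. -/
def delete (D : WeightedOrientedGraph V) (S : Set V) :
    WeightedOrientedGraph {v : V // v ∉ S} where
  Adj u v := D.Adj u.1 v.1
  asymm u v := D.asymm u.1 v.1
  weight v := D.weight v.1
  weight_pos v := D.weight_pos v.1

/-- The edge ideal of `D` in `K[x_v : v ∈ V]`, generated by the monomials
`x_u * x_v ^ w(v)` for the edges `(u, v)`. -/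
noncomputable def edgeIdeal (K : Type*) [Field K] (D : WeightedOrientedGraph V) :
    Ideal (MvPolynomial V K) :=
  Ideal.span {p | ∃ u v, D.Adj u v ∧
    p = MvPolynomial.X u * MvPolynomial.X v ^ D.weight v}

/-- `D` is Cohen-Macaulay over `K` if the quotient of the polynomial ring by the edge ideal is a
Cohen-Macaulay ring. -/
def CohenMacaulay (K : Type*) [Field K] (D : WeightedOrientedGraph V) : Prop :=
  IsCohenMacaulay (MvPolynomial V K ⧸ D.edgeIdeal K)

end WeightedOrientedGraph

/-! Let `A` be the quotient ring of `D_H`. Inverting `y` kills `z`, because some `z * y ^ k` is a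
relation; no other edge meets `y`, so `A` becomes the ring of `D_G` with `y` and its inverse
adjoined. Inverting `z` kills the in-neighbours of `z` (as `w(z) = 1`) and makes each out-neighbour
`x` satisfy `x ^ w(x) = 0`. By the orientation hypothesis every other edge meeting a neighbour is
then redundant, so `A` becomes `B ⊗ Λ` with `z` and its inverse adjoined, where `B` is the ring of
`D_F` and `Λ` is generated by nilpotents.

Two descents finish. The inverted variable `t` is removed by localizing where `t = 1` and cutting by
the regular element `t - 1` (`IsCohenMacaulay.of_surjective_polynomial`). The factor `Λ` is removed
because `B → B ⊗ Λ` is flat with a retraction whose kernel is nil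
(`IsCohenMacaulay.of_tensorProduct`). They rest on `DepthGE.sup_span_singleton` and
`DepthGE.of_flat`. -/

open IsLocalRing

/-! ### Depth of `R ⧸ J` over a local ring, by exchange of regular elements -/

section Depth

variable {R : Type*} [CommRing R] [IsLocalRing R]

/-- `DepthGE d J` says that some sequence of `d` elements of the maximal ideal is weakly regular
on `R ⧸ J`. -/
def DepthGE : ℕ → Ideal R → Prop
  | 0, _ => True
  | d + 1, J => ∃ a ∈ maximalIdeal R, (∀ x, a * x ∈ J → x ∈ J) ∧ DepthGE d (J ⊔ Ideal.span {a})

theorem Ideal.mem_sup_span_singleton_iff {A : Type*} [CommRing A] {J : Ideal A} {a x : A} :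
    x ∈ J ⊔ Ideal.span {a} ↔ ∃ y, x - a * y ∈ J := by
  rw [Submodule.mem_sup]
  constructor
  · rintro ⟨j, hj, b, hb, rfl⟩
    obtain ⟨c, rfl⟩ := Ideal.mem_span_singleton.1 hb
    exact ⟨c, by simpa using hj⟩
  · rintro ⟨y, hy⟩
    exact ⟨_, hy, a * y, Ideal.mem_span_singleton.2 ⟨y, rfl⟩, by ring⟩

theorem regular_mod_swap {A : Type*} [CommRing A] {J : Ideal A} {a e : A}
    (ha : ∀ x, a * x ∈ J → x ∈ J)
    (he : ∀ x, e * x ∈ J ⊔ Ideal.span {a} → x ∈ J ⊔ Ideal.span {a}) (x : A)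
    (hx : a * x ∈ J ⊔ Ideal.span {e}) : x ∈ J ⊔ Ideal.span {e} := by
  simp only [Ideal.mem_sup_span_singleton_iff] at *
  obtain ⟨y, hy⟩ := hx
  obtain ⟨v, hv⟩ := he y ⟨x, by simpa using neg_mem hy⟩
  refine ⟨v, ha _ ?_⟩
  have := add_mem hy (Ideal.mul_mem_left _ e hv)
  convert this using 1
  ring

/-- A relation `a u ≡ c v` mod `J` carries a socle class `u` mod `J + (c)` to a socle class `v` mod
`J + (a)`. This replaces identifying both socles with `Ext¹` of the residue field. -/
theorem socle_transfer {J : Ideal R} {a c : R}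
    (ha : ∀ x, a * x ∈ J → x ∈ J) (hc : ∀ x, c * x ∈ J → x ∈ J)
    (ham : a ∈ maximalIdeal R)
    (h : ∀ u, (∀ t ∈ maximalIdeal R, t * u ∈ J ⊔ Ideal.span {a}) → u ∈ J ⊔ Ideal.span {a})
    (u : R) (hu : ∀ t ∈ maximalIdeal R, t * u ∈ J ⊔ Ideal.span {c}) :
    u ∈ J ⊔ Ideal.span {c} := by
  simp only [Ideal.mem_sup_span_singleton_iff] at *
  obtain ⟨v, hv⟩ := hu a ham
  obtain ⟨v', hv'⟩ := h v fun t ht ↦ by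
    obtain ⟨w, hw⟩ := hu t ht
    refine ⟨w, hc _ ?_⟩
    have := sub_mem (Ideal.mul_mem_left _ a hw) (Ideal.mul_mem_left _ t hv)
    convert this using 1
    ring
  refine ⟨v', ha _ ?_⟩
  have := add_mem hv (Ideal.mul_mem_left _ c hv')
  convert this using 1
  ring

theorem no_socle_of_regular {J : Ideal R} {a : R} (ham : a ∈ maximalIdeal R)
    (ha : ∀ x, a * x ∈ J → x ∈ J) (u : R) (hu : ∀ t ∈ maximalIdeal R, t * u ∈ J) : u ∈ J :=
  ha u (hu a ham)

/-- Otherwise the maximal ideal lies in a finite union of associated primes, hence in one of them,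
and that prime yields a nonzero socle element. -/
theorem exists_regular_of_no_socle [IsNoetherianRing R] (Js : Finset (Ideal R))
    (h : ∀ J ∈ Js, ∀ u, (∀ t ∈ maximalIdeal R, t * u ∈ J) → u ∈ J) :
    ∃ a ∈ maximalIdeal R, ∀ J ∈ Js, ∀ x, a * x ∈ J → x ∈ J := by
  classical
  by_contra! hcon
  have hfin (J : Ideal R) : (associatedPrimes R (R ⧸ J)).Finite := associatedPrimes.finite R _
  let P : Finset (Ideal R) := Js.biUnion fun J ↦ (hfin J).toFinset
  have hP : ∀ p ∈ P, ∃ J ∈ Js, IsAssociatedPrime p (R ⧸ J) := by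
    intro p hp
    obtain ⟨J, hJ, hp⟩ := Finset.mem_biUnion.1 hp
    exact ⟨J, hJ, (hfin J).mem_toFinset.1 hp⟩
  have hsub : ((maximalIdeal R : Ideal R) : Set R) ⊆ ⋃ i ∈ (↑P : Set (Ideal R)), (i : Set R) := by
    intro a ha
    obtain ⟨J, hJ, x, hx, hxJ⟩ := hcon a ha
    have hmem : a ∈ ⋃ p ∈ associatedPrimes R (R ⧸ J), (p : Set R) := by
      rw [biUnion_associatedPrimes_eq_compl_regular]
      intro hreg
      exact hxJ ((isSMulRegular_quotient_iff_mem_of_smul_mem J a).1 hreg x hx)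
    simp only [Set.mem_iUnion] at hmem ⊢
    obtain ⟨p, hp, hap⟩ := hmem
    exact ⟨p, Finset.mem_biUnion.2 ⟨J, hJ, (hfin J).mem_toFinset.2 hp⟩, hap⟩
  obtain ⟨p, hp, hle⟩ := (Ideal.subset_union_prime (f := fun i : Ideal R ↦ i) ⊥ ⊥
    fun p hp _ _ ↦ by obtain ⟨J, _, h⟩ := hP p hp; exact h.isPrime).1 hsub
  obtain ⟨J, hJ, hass⟩ := hP p hp
  obtain ⟨hprime, u, hu⟩ := (isAssociatedPrime_iff_exists_injective_linearMap p _).1 hass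
  obtain ⟨v, hv⟩ := Submodule.mkQ_surjective J (u (Submodule.Quotient.mk 1))
  have hvJ : v ∈ J := h J hJ v fun t ht ↦ by
    rw [← smul_eq_mul, ← Submodule.Quotient.mk_eq_zero, Submodule.Quotient.mk_smul]
    change t • J.mkQ v = 0
    rw [hv, ← map_smul, ← Submodule.Quotient.mk_smul, smul_eq_mul, mul_one,
      (Submodule.Quotient.mk_eq_zero p).2 (hle ht), map_zero]
  have h1 : u (Submodule.Quotient.mk 1) = u 0 := by
    rw [map_zero, ← hv]
    exact (Submodule.Quotient.mk_eq_zero J).2 hvJ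
  exact hprime.ne_top ((Ideal.eq_top_iff_one p).2 ((Submodule.Quotient.mk_eq_zero p).1 (hu h1)))

/-- Any regular element may start the sequence: an `e` regular modulo `J`, `J + (a)` and `J + (c)`
at once is exchanged first with `a`, then with `c`. -/
theorem DepthGE.sup_span_singleton [IsNoetherianRing R] {d : ℕ} {J : Ideal R} {c : R}
    (h : DepthGE (d + 1) J) (hcm : c ∈ maximalIdeal R) (hc : ∀ x, c * x ∈ J → x ∈ J) :
    DepthGE d (J ⊔ Ideal.span {c}) := by
  classical
  induction d generalizing J c with
  | zero => trivial
  | succ d ih =>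
    obtain ⟨a, ham, ha, hd⟩ := h
    obtain ⟨b, hbm, hb, -⟩ := id hd
    have hsa := no_socle_of_regular hbm hb
    obtain ⟨e, hem, he⟩ := exists_regular_of_no_socle
      {J, J ⊔ Ideal.span {a}, J ⊔ Ideal.span {c}} (by
        simp only [Finset.mem_insert, Finset.mem_singleton, forall_eq_or_imp, forall_eq]
        exact ⟨no_socle_of_regular ham ha, hsa, socle_transfer ha hc ham hsa⟩)
    simp only [Finset.mem_insert, Finset.mem_singleton, forall_eq_or_imp, forall_eq] at he
    obtain ⟨heJ, hea, hec⟩ := he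
    have h1 : DepthGE (d + 1) (J ⊔ Ideal.span {e}) :=
      ⟨a, ham, regular_mod_swap ha hea, sup_right_comm J _ _ ▸ ih hd hem hea⟩
    exact ⟨e, hem, hec, sup_right_comm J _ _ ▸ ih h1 hcm (regular_mod_swap hc hec)⟩

/-- A socle element of `R ⧸ J` is killed by a power of the maximal ideal of `S` in `S ⧸ JS`, so a
regular element there forces it to vanish. Thus `R ⧸ J` has a regular element, which stays regular
over `S` by flatness, and both sides can be cut by it. -/
theorem DepthGE.of_flat {S : Type*} [CommRing S] [IsLocalRing S] [IsNoetherianRing R]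
    [IsNoetherianRing S] [Algebra R S] [Module.Flat R S] [IsLocalHom (algebraMap R S)] {N : ℕ}
    (hN : maximalIdeal S ^ N ≤ (maximalIdeal R).map (algebraMap R S)) {d : ℕ} {J : Ideal R}
    (h : DepthGE d (J.map (algebraMap R S))) : DepthGE d J := by
  have : Module.FaithfullyFlat R S := Module.FaithfullyFlat.of_flat_of_isLocalHom
  induction d generalizing J with
  | zero => trivial
  | succ d ih =>
    obtain ⟨b, hbm, hb, -⟩ := id h
    obtain ⟨a, ham, ha⟩ := exists_regular_of_no_socle {J} (by
      simp only [Finset.mem_singleton, forall_eq]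
      intro u hu
      have key (k : ℕ) : ∀ s : S, (∀ t ∈ maximalIdeal S ^ k, t * s ∈ J.map (algebraMap R S)) →
          s ∈ J.map (algebraMap R S) := by
        induction k with
        | zero => intro s hs; simpa using hs 1 (by simp)
        | succ k ihk =>
          intro s hs
          refine no_socle_of_regular hbm hb s fun t ht ↦ ihk _ fun t' ht' ↦ ?_
          rw [← mul_assoc]
          exact hs _ (pow_succ (maximalIdeal S) k ▸ Ideal.mul_mem_mul ht' ht)
      rw [← Ideal.comap_map_eq_self_of_faithfullyFlat (B := S) J, Ideal.mem_comap]
      refine key N _ fun t ht ↦ ?_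
      have h2 : (maximalIdeal R).map (algebraMap R S) ≤
          (J.map (algebraMap R S)).colon {algebraMap R S u} := by
        rw [Ideal.map_le_iff_le_comap]
        intro t ht
        rw [Ideal.mem_comap, Submodule.mem_colon_singleton, smul_eq_mul, ← map_mul]
        exact Ideal.mem_map_of_mem _ (hu t ht)
      simpa [Submodule.mem_colon_singleton] using h2 (hN ht))
    simp only [Finset.mem_singleton, forall_eq] at ha
    refine ⟨a, ham, ha, ih ?_⟩
    rw [Ideal.map_sup, Ideal.map_span, Set.image_singleton]
    refine h.sup_span_singleton (map_nonunit (algebraMap R S) a ham) ?_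
    have h1 : IsSMulRegular (R ⧸ J) a := (isSMulRegular_quotient_iff_mem_of_smul_mem J a).2 ha
    have h2 := h1.lTensor S
    rw [(TensorProduct.tensorQuotEquivQuotSMul S J).isSMulRegular_congr,
      isSMulRegular_quotient_iff_mem_of_smul_mem, Ideal.smul_top_eq_map] at h2
    intro x hx
    exact h2 x (by simpa [Algebra.smul_def] using hx)

theorem DepthGE.of_surjective {S : Type*} [CommRing S] [IsLocalRing S] (f : R →+* S)
    (hf : Function.Surjective f) {d : ℕ} {J : Ideal S} (h : DepthGE d (J.comap f)) :
    DepthGE d J := by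
  induction d generalizing J with
  | zero => trivial
  | succ d ih =>
    obtain ⟨a, ham, ha, hd⟩ := h
    have : IsLocalHom f := hf.isLocalHom
    refine ⟨f a, map_nonunit f a ham, ?_, ih ?_⟩
    · intro y hy
      obtain ⟨x, rfl⟩ := hf y
      exact ha x (by simpa using hy)
    · have hker : RingHom.ker f ≤ J.comap f ⊔ Ideal.span {a} :=
        (Ideal.comap_mono bot_le).trans le_sup_left
      have key : (J ⊔ Ideal.span {f a}).comap f = J.comap f ⊔ Ideal.span {a} := by
        conv_lhs => rw [← Ideal.map_comap_of_surjective f hf J, ← Set.image_singleton,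
          ← Ideal.map_span, ← Ideal.map_sup, Ideal.comap_map_of_surjective' f hf]
        exact sup_eq_left.2 hker
      rwa [key]

/-! ### Regular sequences and Cohen–Macaulay local rings -/

open RingTheory.Sequence

/-- `(R ⧸ J) ⧸ a (R ⧸ J)` is `R ⧸ (J + (a))`. -/
noncomputable def quotSMulTopQuotientEquiv {A : Type*} [CommRing A] (J : Ideal A) (a : A) :
    QuotSMulTop a (A ⧸ J) ≃ₗ[A] A ⧸ (J ⊔ Ideal.span {a}) :=
  (Submodule.quotEquivOfEq _ _ (by
    rw [← Submodule.ideal_span_singleton_smul, ← Submodule.range_mkQ J, ← Submodule.map_top,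
      ← Submodule.map_smul'', smul_eq_mul, Ideal.mul_top])).trans
    (Submodule.quotientQuotientEquivQuotientSup J (Ideal.span {a}))

theorem depthGE_iff {d : ℕ} {J : Ideal R} : DepthGE d J ↔ ∃ rs : List R,
    rs.length = d ∧ (∀ r ∈ rs, r ∈ maximalIdeal R) ∧ IsWeaklyRegular (R ⧸ J) rs := by
  induction d generalizing J with
  | zero =>
    exact ⟨fun _ ↦ ⟨[], rfl, by simp, by simp⟩, fun _ ↦ trivial⟩
  | succ d ih =>
    constructor
    · rintro ⟨a, ham, ha, hd⟩
      obtain ⟨rs, hl, hrs, hreg⟩ := ih.1 hd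
      refine ⟨a :: rs, by simp [hl], by simpa using ⟨ham, hrs⟩, ?_⟩
      rw [isWeaklyRegular_cons_iff, (quotSMulTopQuotientEquiv J a).isWeaklyRegular_congr]
      exact ⟨(isSMulRegular_quotient_iff_mem_of_smul_mem J a).2 ha, hreg⟩
    · rintro ⟨rs, hl, hrs, hreg⟩
      obtain _ | ⟨a, rs⟩ := rs
      · simp at hl
      rw [isWeaklyRegular_cons_iff, (quotSMulTopQuotientEquiv J a).isWeaklyRegular_congr] at hreg
      exact ⟨a, hrs a (by simp), (isSMulRegular_quotient_iff_mem_of_smul_mem J a).1 hreg.1,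
        ih.2 ⟨rs, by simpa using hl, fun r hr ↦ hrs r (by simp [hr]), hreg.2⟩⟩

theorem depthGE_bot_iff {d : ℕ} : DepthGE d (⊥ : Ideal R) ↔ ∃ rs : List R,
    rs.length = d ∧ (∀ r ∈ rs, r ∈ maximalIdeal R) ∧ IsRegular R rs := by
  rw [depthGE_iff]
  refine exists_congr fun rs ↦ and_congr_right fun _ ↦ and_congr_right fun hrs ↦ ?_
  rw [IsLocalRing.isRegular_iff_isWeaklyRegular_of_subset_maximalIdeal hrs]
  exact (Submodule.quotEquivOfEqBot (⊥ : Ideal R) rfl).isWeaklyRegular_congr rs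

theorem IsCohenMacaulayLocal.of_depthGE [IsNoetherianRing R] {d : ℕ}
    (h : DepthGE d (⊥ : Ideal R)) (hd : ringKrullDim R ≤ d) : IsCohenMacaulayLocal R := by
  refine ⟨‹_›, le_antisymm ?_ ?_⟩
  · have hne : ringKrullDim R ≠ ⊥ := ringKrullDim_ne_bot
    obtain ⟨e, he⟩ := WithBot.ne_bot_iff_exists.1 hne
    rw [← he, WithBot.coe_le_coe, localRingDepth]
    refine iSup_le fun rs ↦ ?_
    rw [← WithBot.coe_le_coe, he,
      ← ringKrullDim_add_length_eq_ringKrullDim_of_isRegular rs.1 rs.2.2]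
    have : Nontrivial (R ⧸ Ideal.ofList rs.1) :=
      Ideal.Quotient.nontrivial_iff.2 fun h ↦ rs.2.2.top_ne_smul (by rw [h]; simp)
    exact le_add_of_nonneg_left ringKrullDim_nonneg_of_nontrivial
  · obtain ⟨rs, hl, hrs, hreg⟩ := depthGE_bot_iff.1 h
    refine hd.trans ?_
    have : (d : ℕ∞) ≤ localRingDepth R := by
      rw [← hl]
      exact le_iSup (fun rs : {rs : List R // (∀ r ∈ rs, r ∈ maximalIdeal R) ∧ IsRegular R rs} ↦
        (rs.1.length : ℕ∞)) ⟨rs, hrs, hreg⟩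
    exact_mod_cast this

theorem IsCohenMacaulayLocal.exists_depthGE (h : IsCohenMacaulayLocal R) :
    ∃ d : ℕ, ringKrullDim R = d ∧ DepthGE d (⊥ : Ideal R) := by
  have := h.noetherian
  have hlt : localRingDepth R < ⊤ := by
    have := ringKrullDim_lt_top (R := R)
    rw [← h.depth_eq_dim] at this
    exact WithBot.coe_lt_coe.1 this
  have : Nonempty {rs : List R // (∀ r ∈ rs, r ∈ maximalIdeal R) ∧ IsRegular R rs} :=
    ⟨⟨[], by simp, IsRegular.nil R R⟩⟩
  obtain ⟨⟨rs, hrs, hreg⟩, hl⟩ := ENat.exists_eq_iSup_of_lt_top hlt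
  refine ⟨rs.length, ?_, depthGE_bot_iff.2 ⟨rs, rfl, hrs, hreg⟩⟩
  rw [← h.depth_eq_dim, localRingDepth, ← hl]
  rfl

/-- Dimension drops by exactly one modulo `q`, and depth by at most one. -/
theorem IsCohenMacaulayLocal.of_surjective_of_ker_eq_span {S : Type*} [CommRing S] [IsLocalRing S]
    (h : IsCohenMacaulayLocal R) (f : R →+* S) (hf : Function.Surjective f) {q : R}
    (hq : ∀ x, q * x = 0 → x = 0) (hker : RingHom.ker f = Ideal.span {q}) :
    IsCohenMacaulayLocal S := by
  have := h.noetherian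
  have := isNoetherianRing_of_surjective R S f hf
  have : IsLocalHom f := hf.isLocalHom
  have hqm : q ∈ maximalIdeal R := by
    have : f q = 0 := by rw [← RingHom.mem_ker, hker]; exact Ideal.mem_span_singleton_self q
    intro hu
    exact not_isUnit_zero (this ▸ hu.map f)
  obtain ⟨d, hd, hD⟩ := h.exists_depthGE
  have hdim : ringKrullDim S + 1 = d := by
    rw [← hd, ← ringKrullDim_quotient_span_singleton_succ_eq_ringKrullDim
      (isSMulRegular_iff_right_eq_zero_of_smul.2 hq) hqm, ← hker,
      ringKrullDim_eq_of_ringEquiv (RingHom.quotientKerEquivOfSurjective hf)]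
  obtain _ | d := d
  · have h0 : (0 : WithBot ℕ∞) ≤ ringKrullDim S := ringKrullDim_nonneg_of_nontrivial
    have : (1 : WithBot ℕ∞) ≤ 0 := by
      calc (1 : WithBot ℕ∞) ≤ ringKrullDim S + 1 := le_add_of_nonneg_left h0
        _ = 0 := by simpa using hdim
    exact absurd this (by decide)
  · refine .of_depthGE (d := d) (.of_surjective f hf ?_) ?_
    · have := hD.sup_span_singleton hqm (by simpa using hq)
      rw [bot_sup_eq, ← hker] at this
      exact this
    · have : ringKrullDim S + 1 ≤ (d : WithBot ℕ∞) + 1 := by rw [hdim]; simp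
      exact (ENat.WithBot.add_le_add_one_right_iff).1 this

theorem IsCohenMacaulayLocal.of_flat {S : Type*} [CommRing S] [IsLocalRing S] [IsNoetherianRing R]
    (h : IsCohenMacaulayLocal S) {f : R →+* S} (hflat : f.Flat) [IsLocalHom f] {N : ℕ}
    (hN : maximalIdeal S ^ N ≤ (maximalIdeal R).map f) (g : S →+* R)
    (hg : Function.Surjective g) : IsCohenMacaulayLocal R := by
  algebraize [f]
  have := h.noetherian
  obtain ⟨d, hd, hD⟩ := h.exists_depthGE
  have : IsLocalHom (algebraMap R S) := ‹IsLocalHom f›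
  refine .of_depthGE (d := d) (.of_flat (S := S) hN (by rwa [Ideal.map_bot])) ?_
  exact hd ▸ ringKrullDim_le_of_surjective g hg

end Depth

/-! ### Descent of the Cohen–Macaulay property -/

/-- Evaluation is at `1`, not `0`: at primes containing `t - 1` the element `t` is a unit, so the
`t`-power torsion dies and `t - 1` becomes regular. -/
theorem IsCohenMacaulay.of_surjective_polynomial {A E : Type*} [CommRing A] [CommRing E]
    (hA : IsCohenMacaulay A) (π : A →+* Polynomial E) (hπ : Function.Surjective π) (t : A)
    (ht : π t = Polynomial.X) (k : ℕ)
    (hker : ∀ a, π a = 0 → t ^ k * a = 0) : IsCohenMacaulay E := by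
  let ψ : A →+* E := (Polynomial.evalRingHom 1).comp π
  have hψ : Function.Surjective ψ := fun e ↦ by
    obtain ⟨a, ha⟩ := hπ (Polynomial.C e)
    exact ⟨a, by simp [ψ, ha]⟩
  have hψt : ψ t = 1 := by simp [ψ, ht]
  have hψker (a : A) (ha : ψ a = 0) : ∃ b, t ^ k * a = (t - 1) * b := by
    obtain ⟨g, hg⟩ := Polynomial.dvd_iff_isRoot.2 (show (π a).IsRoot 1 from ha)
    obtain ⟨g, rfl⟩ := hπ g
    refine ⟨t ^ k * g, ?_⟩
    have := hker (a - (t - 1) * g) (by simp [hg, ht])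
    linear_combination this
  have hreg (a : A) (ha : (t - 1) * a = 0) : t ^ k * a = 0 := by
    refine hker a ((Polynomial.monic_X_sub_C (1 : E)).mul_right_eq_zero_iff.1 ?_)
    have := congrArg π ha
    simpa [ht] using this
  refine ⟨have := hA.noetherian; isNoetherianRing_of_surjective A E ψ hψ, fun p hp ↦ ?_⟩
  have : (p.comap ψ).IsMaximal := Ideal.comap_isMaximal_of_surjective ψ hψ
  have htp : t ^ k ∉ p.comap ψ := fun h ↦ hp.ne_top ((Ideal.eq_top_iff_one p).2 (by simpa [hψt] using h))
  let L := algebraMap A (Localization.AtPrime (p.comap ψ))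
  let f := Localization.localRingHom (p.comap ψ) p ψ rfl
  refine (hA.localization (p.comap ψ)).of_surjective_of_ker_eq_span f ?_ (q := L (t - 1)) ?_ ?_
  · intro x
    obtain ⟨e, ⟨s, hs⟩, rfl⟩ := IsLocalization.exists_mk'_eq p.primeCompl x
    obtain ⟨a, rfl⟩ := hψ e
    obtain ⟨u, rfl⟩ := hψ s
    exact ⟨IsLocalization.mk' _ a ⟨u, hs⟩, Localization.localRingHom_mk' ..⟩
  · intro x hx
    obtain ⟨a, s, rfl⟩ := IsLocalization.exists_mk'_eq (p.comap ψ).primeCompl x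
    rw [IsLocalization.mul_mk'_eq_mk'_of_mul, IsLocalization.mk'_eq_zero_iff] at hx
    obtain ⟨u, hu⟩ := hx
    rw [IsLocalization.mk'_eq_zero_iff]
    refine ⟨⟨t ^ k, htp⟩ * u, ?_⟩
    have := hreg (u * a) (by rw [← hu]; ring)
    rw [← this]
    simp [mul_assoc]
  · ext x
    obtain ⟨a, s, rfl⟩ := IsLocalization.exists_mk'_eq (p.comap ψ).primeCompl x
    rw [RingHom.mem_ker, Ideal.mem_span_singleton]
    constructor
    · intro h
      rw [Localization.localRingHom_mk', IsLocalization.mk'_eq_zero_iff] at h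
      obtain ⟨⟨u, hu⟩, hua⟩ := h
      obtain ⟨u, rfl⟩ := hψ u
      obtain ⟨b, hb⟩ := hψker (u * a) (by simpa using hua)
      refine ⟨IsLocalization.mk' _ b (⟨t ^ k, htp⟩ * ⟨u, hu⟩ * s), ?_⟩
      rw [IsLocalization.mul_mk'_eq_mk'_of_mul, IsLocalization.mk'_eq_iff_eq]
      congr 1
      simp only [Submonoid.coe_mul]
      linear_combination (s : A) * hb
    · rintro ⟨y, hy⟩
      rw [hy, map_mul, Localization.localRingHom_to_map]
      simp [hψt]

/-- Since `ker g` is nilpotent, a power of `m.comap g` lies in the extension of `m`, so depth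
descends; the surjection `g` bounds the dimension. -/
theorem IsCohenMacaulay.of_flat_of_leftInverse {B E : Type*} [CommRing B] [CommRing E]
    (hE : IsCohenMacaulay E) (ι : B →+* E) (hι : ι.Flat) (g : E →+* B)
    (hg : ∀ b, g (ι b) = b) (hker : RingHom.ker g ≤ nilradical E) : IsCohenMacaulay B := by
  have := hE.noetherian
  have hgs : Function.Surjective g := fun b ↦ ⟨_, hg b⟩
  have hB : IsNoetherianRing B := isNoetherianRing_of_surjective E B g hgs
  refine ⟨hB, fun m hm ↦ ?_⟩
  have : (m.comap g).IsMaximal := Ideal.comap_isMaximal_of_surjective g hgs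
  have hcomap : m = (m.comap g).comap ι := by ext; simp [hg]
  obtain ⟨N, hN⟩ : ∃ N, RingHom.ker g ^ N = ⊥ := by
    obtain ⟨N, hN⟩ := Ideal.exists_pow_le_of_le_radical_of_fg hker (IsNoetherian.noetherian _)
    exact ⟨N, le_bot_iff.1 hN⟩
  have hle : m.comap g ≤ m.map ι ⊔ RingHom.ker g := by
    intro x hx
    rw [← add_sub_cancel (ι (g x)) x]
    exact add_mem (Ideal.mem_sup_left (Ideal.mem_map_of_mem _ hx))
      (Ideal.mem_sup_right (by simp [RingHom.mem_ker, hg]))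
  have hpow : m.comap g ^ (1 + N) ≤ m.map ι := by
    refine (Ideal.pow_right_mono hle _).trans (Ideal.sup_pow_add_le_pow_sup_pow.trans ?_)
    simp [hN]
  let f := Localization.localRingHom m (m.comap g) ι hcomap
  have : IsLocalHom f := Localization.isLocalHom_localRingHom ..
  refine (hE.localization (m.comap g)).of_flat (f := f) (hι.localRingHom _ _ hcomap)
    (N := 1 + N) ?_ (Localization.localRingHom (m.comap g) m g rfl) ?_
  · rw [← Localization.AtPrime.map_eq_maximalIdeal, ← Localization.AtPrime.map_eq_maximalIdeal,
      ← Ideal.map_pow, Ideal.map_map]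
    refine (Ideal.map_mono hpow).trans ?_
    rw [Ideal.map_map]
    refine le_of_eq (congrArg (Ideal.map · m) ?_)
    ext b
    exact (Localization.localRingHom_to_map _ _ ι hcomap b).symm
  · intro x
    refine ⟨f x, ?_⟩
    rw [← RingHom.comp_apply, ← Localization.localRingHom_comp]
    obtain ⟨e, s, rfl⟩ := IsLocalization.exists_mk'_eq m.primeCompl x
    rw [Localization.localRingHom_mk']
    simp [hg]

open scoped TensorProduct in
-- Modulo nilpotents each element of `Λ` equals its augmentation, so reduction modulo the nilradical
-- factors through `g`.
theorem IsCohenMacaulay.of_tensorProduct {K B Λ : Type*} [Field K] [CommRing B] [CommRing Λ]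
    [Algebra K B] [Algebra K Λ] (h : IsCohenMacaulay (B ⊗[K] Λ)) (aug : Λ →ₐ[K] K)
    (haug : RingHom.ker aug ≤ nilradical Λ) : IsCohenMacaulay B := by
  let g : B ⊗[K] Λ →ₐ[K] B :=
    Algebra.TensorProduct.lift (AlgHom.id K B) ((Algebra.ofId K B).comp aug)
      fun _ _ ↦ Commute.all _ _
  have hgl (b : B) : g (b ⊗ₜ 1) = b := by simp [g]
  have hflat : (algebraMap B (B ⊗[K] Λ)).Flat := RingHom.flat_algebraMap_iff.2 inferInstance
  refine h.of_flat_of_leftInverse _ hflat (g : B ⊗[K] Λ →+* B) hgl fun x hx ↦ ?_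
  let q := Ideal.Quotient.mkₐ K (nilradical (B ⊗[K] Λ))
  have key : q = (q.comp Algebra.TensorProduct.includeLeft).comp g := by
    ext x
    · simp [hgl]
    · have hnil : x - algebraMap K Λ (aug x) ∈ nilradical Λ := haug (by simp [RingHom.mem_ker])
      have := (mem_nilradical.1 hnil).map (Algebra.TensorProduct.includeRight : Λ →ₐ[K] B ⊗[K] Λ)
      have h0 := (Ideal.Quotient.eq_zero_iff_mem).2 (mem_nilradical.2 this)
      rw [map_sub, map_sub, sub_eq_zero] at h0
      refine h0.trans ?_
      simp [g, q, Algebra.ofId_apply]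
  have hx' : g x = 0 := hx
  have := DFunLike.congr_fun key x
  rw [AlgHom.comp_apply, hx', map_zero] at this
  exact Ideal.Quotient.eq_zero_iff_mem.1 this

open scoped TensorProduct

open MvPolynomial in
-- The map back through `σ` shows that `ker π` lies in `I : t ^ k`; this torsion bound suffices, and
-- `ker π` need not be computed.
theorem IsCohenMacaulay.of_algHom_polynomial {K V E : Type*} [Field K] [CommRing E] [Algebra K E]
    {I : Ideal (MvPolynomial V K)} (h : IsCohenMacaulay (MvPolynomial V K ⧸ I))
    (π : MvPolynomial V K →ₐ[K] Polynomial E) (hπI : ∀ f ∈ I, π f = 0)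
    (hπ : ∀ e, ∃ f, π f = Polynomial.C e) (t : V) (ht : π (X t) = Polynomial.X) (k : ℕ)
    (σ : E →ₐ[K] MvPolynomial V K ⧸ I.colon {(X t : MvPolynomial V K) ^ k})
    (hσ : ∀ v, Polynomial.aevalTower σ (Ideal.Quotient.mk _ (X t))
      (π (X v)) = Ideal.Quotient.mk _ (X v)) : IsCohenMacaulay E := by
  refine h.of_surjective_polynomial (Ideal.Quotient.lift I (π : MvPolynomial V K →+* _) hπI) ?_
    (Ideal.Quotient.mk I (X t)) ht k ?_
  · refine Ideal.Quotient.lift_surjective_of_surjective _ _ fun p ↦ ?_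
    suffices p ∈ π.range from this
    induction p using Polynomial.induction_on' with
    | add p q hp hq => exact add_mem hp hq
    | monomial n e =>
      rw [← Polynomial.C_mul_X_pow_eq_monomial]
      exact mul_mem (hπ e) (pow_mem (show Polynomial.X ∈ π.range from ⟨_, ht⟩) n)
  · intro a ha
    obtain ⟨f, rfl⟩ := Ideal.Quotient.mk_surjective a
    have key : (Polynomial.aevalTower σ (Ideal.Quotient.mk _ (X t))).comp π = Ideal.Quotient.mkₐ K _ := algHom_ext hσ
    have hf := DFunLike.congr_fun key f
    have hπf : π f = 0 := ha
    rw [AlgHom.comp_apply, hπf, map_zero] at hf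
    have := Ideal.Quotient.eq_zero_iff_mem.1 hf.symm
    rw [Submodule.mem_colon_singleton, smul_eq_mul, mul_comm] at this
    rw [← map_pow, ← map_mul]
    exact Ideal.Quotient.eq_zero_iff_mem.2 this

/-! ### Edge ideals after inverting a variable -/

namespace WeightedOrientedGraph

open MvPolynomial

variable {V K : Type*} [Field K] (D : WeightedOrientedGraph V)

theorem mem_neighbors_iff {D : WeightedOrientedGraph V} {u v : V} :
    v ∈ D.neighbors u ↔ D.Adj u v ∨ D.Adj v u := by
  simp only [neighbors, underlying, SimpleGraph.mem_neighborSet, Digraph.toSimpleGraphInclusive]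
  refine ⟨fun h ↦ by simpa using h.2, fun h ↦ ⟨?_, by simpa using h⟩⟩
  rintro rfl
  exact h.elim (fun h ↦ D.asymm _ _ h h) (fun h ↦ D.asymm _ _ h h)

theorem map_eq_zero_of_mem_edgeIdeal {D : WeightedOrientedGraph V} {A : Type*} [CommRing A]
    [Algebra K A] (φ : MvPolynomial V K →ₐ[K] A)
    (h : ∀ u v, D.Adj u v → φ (X u) * φ (X v) ^ D.weight v = 0) :
    ∀ f ∈ D.edgeIdeal K, φ f = 0 := by
  suffices D.edgeIdeal K ≤ RingHom.ker φ from fun f hf ↦ this hf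
  refine Ideal.span_le.2 ?_
  rintro _ ⟨u, v, huv, rfl⟩
  simpa [RingHom.mem_ker] using h u v huv

theorem mem_edgeIdeal {D : WeightedOrientedGraph V} {u v : V} (h : D.Adj u v) :
    (X u * X v ^ D.weight v : MvPolynomial V K) ∈ D.edgeIdeal K :=
  Ideal.subset_span ⟨u, v, h, rfl⟩

/-- The map from the quotient by the edge ideal of an induced subgraph to the quotient by an ideal
containing the edge ideal. -/
noncomputable def deleteMap (S : Set V) {Q : Ideal (MvPolynomial V K)} (hQ : D.edgeIdeal K ≤ Q) :
    (MvPolynomial {v // v ∉ S} K ⧸ (D.delete S).edgeIdeal K) →ₐ[K] MvPolynomial V K ⧸ Q :=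
  Ideal.Quotient.liftₐ _ (aeval fun v ↦ Ideal.Quotient.mk Q (X v.1)) <|
    map_eq_zero_of_mem_edgeIdeal _ fun u v huv ↦ by
      simp only [aeval_X, ← map_pow, ← map_mul]
      exact Ideal.Quotient.eq_zero_iff_mem.2 (hQ (mem_edgeIdeal huv))

theorem deleteMap_mk_X (S : Set V) {Q : Ideal (MvPolynomial V K)} (hQ : D.edgeIdeal K ≤ Q)
    (v : {v // v ∉ S}) :
    D.deleteMap S hQ (Ideal.Quotient.mk _ (X v)) = Ideal.Quotient.mk Q (X v.1) :=
  (Ideal.Quotient.lift_mk _ _ _).trans (aeval_X _ _)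

theorem map_eq_zero_of_mem_span_pow {σ A : Type*} [CommRing A] [Algebra K A] {e : σ → ℕ}
    (φ : MvPolynomial σ K →ₐ[K] A) (h : ∀ v, φ (X v) ^ e v = 0) :
    ∀ f ∈ Ideal.span (Set.range fun v : σ ↦ (X v ^ e v : MvPolynomial σ K)), φ f = 0 := by
  suffices Ideal.span (Set.range fun v : σ ↦ (X v ^ e v : MvPolynomial σ K)) ≤ RingHom.ker φ from
    fun f hf ↦ this hf
  refine Ideal.span_le.2 ?_
  rintro _ ⟨v, rfl⟩
  simpa [RingHom.mem_ker] using h v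

theorem adjoin_range_mk_X {σ : Type*} (J : Ideal (MvPolynomial σ K)) :
    Algebra.adjoin K (Set.range fun v ↦ Ideal.Quotient.mk J (X v)) = ⊤ := by
  refine eq_top_iff.2 fun q _ ↦ ?_
  obtain ⟨p, rfl⟩ := Ideal.Quotient.mk_surjective q
  induction p using MvPolynomial.induction_on with
  | C a => exact Subalgebra.algebraMap_mem _ a
  | add p q hp hq => rw [map_add]; exact add_mem (hp trivial) (hq trivial)
  | mul_X p v hp =>
    rw [map_mul]
    exact mul_mem (hp trivial) (Algebra.subset_adjoin ⟨v, rfl⟩)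

theorem mem_range_of_adjoin_eq_top {ι A B T : Type*} [CommRing A] [Algebra K A] [CommRing T]
    [Algebra K T] [CommRing B] [Algebra K B] {b : ι → B}
    (hb : Algebra.adjoin K (Set.range b) = ⊤) (φ : A →ₐ[K] T) (ψ : B →ₐ[K] T)
    (h : ∀ v, ψ (b v) ∈ φ.range) (q : B) : ψ q ∈ φ.range := by
  have : Algebra.adjoin K (Set.range b) ≤ φ.range.comap ψ := by
    refine Algebra.adjoin_le ?_
    rintro _ ⟨v, rfl⟩
    exact h v
  exact this (hb ▸ Algebra.mem_top)

theorem mem_range_of_tensorProduct {A B Λ T : Type*} [CommRing A] [Algebra K A] [CommRing T]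
    [Algebra K T] [CommRing B] [Algebra K B] [CommRing Λ] [Algebra K Λ] (φ : A →ₐ[K] T)
    (ψ : B ⊗[K] Λ →ₐ[K] T) (hB : ∀ b, ψ (b ⊗ₜ 1) ∈ φ.range) (hΛ : ∀ l, ψ (1 ⊗ₜ l) ∈ φ.range)
    (w : B ⊗[K] Λ) : ψ w ∈ φ.range := by
  induction w using TensorProduct.induction_on with
  | zero => rw [map_zero]; exact zero_mem _
  | add p q hp hq => rw [map_add]; exact add_mem hp hq
  | tmul p q =>
    rw [← mul_one p, ← one_mul q, ← Algebra.TensorProduct.tmul_mul_tmul, map_mul]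
    exact mul_mem (hB p) (hΛ q)

theorem le_colon_singleton {A : Type*} [CommRing A] (I : Ideal A) (a : A) : I ≤ I.colon {a} :=
  fun x hx ↦ by simpa [Submodule.mem_colon_singleton] using I.mul_mem_right a hx

open Classical in
theorem CohenMacaulay.delete_pendant {H : WeightedOrientedGraph V} {z y : V}
    (hCM : H.CohenMacaulay K) (hy : H.neighbors y = {z}) (hw : H.weight z = 1) :
    (H.delete {z, y}).CohenMacaulay K := by
  have hyz : H.Adj y z ∨ H.Adj z y := mem_neighbors_iff.1 (hy ▸ rfl)
  have hne : z ≠ y := by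
    rintro rfl
    exact hyz.elim (fun h ↦ H.asymm _ _ h h) (fun h ↦ H.asymm _ _ h h)
  have hyu {u : V} (h : H.Adj y u ∨ H.Adj u y) : u = z := by
    have := mem_neighbors_iff.2 h
    rwa [hy] at this
  -- `k = 1` if the edge enters `z`, by `w(z) = 1`; otherwise `k = w(y)`.
  obtain ⟨k, hk⟩ : ∃ k, (X z * X y ^ k : MvPolynomial V K) ∈ H.edgeIdeal K := by
    obtain h | h := hyz
    · exact ⟨1, by simpa [hw, mul_comm] using mem_edgeIdeal (K := K) h⟩
    · exact ⟨_, mem_edgeIdeal h⟩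
  let E := MvPolynomial {v // v ∉ ({z, y} : Set V)} K ⧸ (H.delete {z, y}).edgeIdeal K
  let c : V → Polynomial E := fun v ↦
    if hv : v ∉ ({z, y} : Set V) then Polynomial.C (Ideal.Quotient.mk _ (X ⟨v, hv⟩))
    else if v = z then 0 else Polynomial.X
  have cz : c z = 0 := by simp [c]
  have cy : c y = Polynomial.X := by simp [c, hne.symm]
  have cv (v : V) (hv : v ∉ ({z, y} : Set V)) :
      c v = Polynomial.C (Ideal.Quotient.mk _ (X ⟨v, hv⟩)) := dif_pos hv
  have hwpos (v : V) : H.weight v ≠ 0 := (H.weight_pos v).ne'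
  refine IsCohenMacaulay.of_algHom_polynomial hCM (aeval c) ?_ ?_ y (by simp [cy]) k
    (H.deleteMap _ (le_colon_singleton _ _)) ?_
  · refine map_eq_zero_of_mem_edgeIdeal _ fun u v huv ↦ ?_
    simp only [aeval_X]
    by_cases hu : u = z
    · simp [hu, cz]
    by_cases hv : v = z
    · simp [hv, cz, hwpos]
    have hu' : u ∉ ({z, y} : Set V) := by
      rintro (rfl | rfl)
      exacts [hu rfl, hv (hyu (.inl huv))]
    have hv' : v ∉ ({z, y} : Set V) := by
      rintro (rfl | rfl)
      exacts [hv rfl, hu (hyu (.inr huv))]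
    rw [cv u hu', cv v hv', ← map_pow, ← map_mul, ← map_pow, ← map_mul,
      Ideal.Quotient.eq_zero_iff_mem.2, map_zero]
    exact mem_edgeIdeal (D := H.delete {z, y}) (u := ⟨u, hu'⟩) (v := ⟨v, hv'⟩) huv
  · exact mem_range_of_adjoin_eq_top (adjoin_range_mk_X _) (aeval c) Polynomial.CAlgHom
      fun v ↦ ⟨X v.1, (aeval_X _ _).trans (cv v.1 v.2)⟩
  · intro v
    rw [aeval_X]
    by_cases hvz : v = z
    · subst hvz
      rw [cz, map_zero, eq_comm, Ideal.Quotient.eq_zero_iff_mem, Submodule.mem_colon_singleton]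
      exact hk
    by_cases hvy : v = y
    · subst hvy
      rw [cy]
      simp
    rw [cv v (by simp [hvz, hvy])]
    simpa using deleteMap_mk_X ..

open Classical in
theorem CohenMacaulay.tensorProduct_of_generators {H : WeightedOrientedGraph V} {z : V} {S : Set V}
    (hCM : H.CohenMacaulay K) (hS : S = {z} ∪ H.neighbors z)
    (h : ∀ x v, H.Adj z x → v ∉ S → ¬ H.Adj x v) {B Λ : Type*} [CommRing B] [Algebra K B]
    [CommRing Λ] [Algebra K Λ] (b : {v // v ∉ S} → B) (hb : Algebra.adjoin K (Set.range b) = ⊤)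
    (hbe : ∀ u v, H.Adj u.1 v.1 → b u * b v ^ H.weight v.1 = 0)
    (x : H.neighbors z → Λ) (hx : Algebra.adjoin K (Set.range x) = ⊤)
    (hxw : ∀ v, x v ^ H.weight v.1 = 0) (hx0 : ∀ v, ¬ H.Adj z v.1 → x v = 0)
    (σB : B →ₐ[K] MvPolynomial V K ⧸ (H.edgeIdeal K).colon {(X z : MvPolynomial V K) ^ 1})
    (hσB : ∀ v, σB (b v) = Ideal.Quotient.mk _ (X v.1))
    (σΛ : Λ →ₐ[K] MvPolynomial V K ⧸ (H.edgeIdeal K).colon {(X z : MvPolynomial V K) ^ 1})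
    (hσΛ : ∀ v, σΛ (x v) = Ideal.Quotient.mk _ (X v.1)) :
    IsCohenMacaulay (B ⊗[K] Λ) := by
  let N := H.neighbors z
  have hzN : z ∉ N := fun hz ↦
    (mem_neighbors_iff.1 hz).elim (fun h ↦ H.asymm _ _ h h) (fun h ↦ H.asymm _ _ h h)
  let c : V → Polynomial (B ⊗[K] Λ) := fun v ↦
    if hv : v ∉ S then Polynomial.C (b ⟨v, hv⟩ ⊗ₜ 1)
    else if hv : v ∈ N then Polynomial.C (1 ⊗ₜ x ⟨v, hv⟩) else Polynomial.X
  have hzS : z ∈ S := by simp [hS]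
  have hNS {v : V} (hv : v ∈ N) : v ∈ S := by rw [hS]; exact .inr hv
  have cz : c z = Polynomial.X := by simp [c, hzS, hzN]
  have cN (v : V) (hv : v ∈ N) : c v = Polynomial.C (1 ⊗ₜ x ⟨v, hv⟩) := by simp [c, hNS hv, hv]
  have cS (v : V) (hv : v ∉ S) : c v = Polynomial.C (b ⟨v, hv⟩ ⊗ₜ 1) := dif_pos hv
  have cases (v : V) : v = z ∨ v ∈ N ∨ v ∉ S := by
    by_cases hv : v ∈ S
    · rw [hS] at hv
      exact hv.imp id .inl
    · exact .inr (.inr hv)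
  have hpow {v : V} (hv : v ∈ N) : c v ^ H.weight v = 0 := by
    rw [cN v hv, ← map_pow, Algebra.TensorProduct.tmul_pow, hxw ⟨v, hv⟩, TensorProduct.tmul_zero,
      map_zero]
  have hzero {v : V} (hv : v ∈ N) (h : ¬ H.Adj z v) : c v = 0 := by
    rw [cN v hv, hx0 ⟨v, hv⟩ h, TensorProduct.tmul_zero, map_zero]
  refine IsCohenMacaulay.of_algHom_polynomial hCM (aeval c) ?_ ?_ z (by simp [cz]) 1
    (Algebra.TensorProduct.lift σB σΛ fun _ _ ↦ Commute.all _ _) ?_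
  · refine map_eq_zero_of_mem_edgeIdeal _ fun u v huv ↦ ?_
    simp only [aeval_X]
    -- Head `z`: the tail is an in-neighbour, sent to `0`. Head a neighbour of `z`: its power
    -- vanishes. Head in `D_F`: by `h` the tail is an in-neighbour or lies in `D_F`.
    obtain rfl | hv | hv := cases v
    · rw [hzero (mem_neighbors_iff.2 (.inr huv)) fun h ↦ H.asymm _ _ h huv, zero_mul]
    · rw [hpow hv, mul_zero]
    obtain rfl | hu | hu := cases u
    · exact absurd (hNS (mem_neighbors_iff.2 (.inl huv))) hv
    · rw [hzero hu fun hzu ↦ h u v hzu hv huv, zero_mul]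
    rw [cS u hu, cS v hv, ← map_pow, ← map_mul, Algebra.TensorProduct.tmul_pow,
      Algebra.TensorProduct.tmul_mul_tmul, hbe ⟨u, hu⟩ ⟨v, hv⟩ huv, TensorProduct.zero_tmul,
      map_zero]
  · refine mem_range_of_tensorProduct (aeval c) Polynomial.CAlgHom ?_ ?_
    · exact mem_range_of_adjoin_eq_top hb (aeval c)
        (Polynomial.CAlgHom.comp Algebra.TensorProduct.includeLeft)
        fun v ↦ ⟨X v.1, (aeval_X _ _).trans (cS v.1 v.2)⟩
    · exact mem_range_of_adjoin_eq_top hx (aeval c)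
        (Polynomial.CAlgHom.comp Algebra.TensorProduct.includeRight)
        fun v ↦ ⟨X v.1, (aeval_X _ _).trans (cN v.1 v.2)⟩
  · intro v
    rw [aeval_X]
    obtain rfl | hv | hv := cases v
    · rw [cz, Polynomial.aevalTower_X]
    · rw [cN v hv, Polynomial.aevalTower_C, Algebra.TensorProduct.lift_tmul, map_one, one_mul,
        hσΛ]
    · rw [cS v hv, Polynomial.aevalTower_C, Algebra.TensorProduct.lift_tmul, map_one, mul_one,
        hσB]

open Classical in
theorem CohenMacaulay.delete_neighbors {H : WeightedOrientedGraph V} {z : V} {S : Set V}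
    (hCM : H.CohenMacaulay K) (hS : S = {z} ∪ H.neighbors z) (hw : H.weight z = 1)
    (h : ∀ x v, H.Adj z x → v ∉ S → ¬ H.Adj x v) :
    (H.delete S).CohenMacaulay K := by
  -- Exponents with `x_v ^ e v` in `I : z`; for an in-neighbour, `w(z) = 1` gives `1`.
  let e : H.neighbors z → ℕ := fun v ↦ if H.Adj z v then H.weight v else 1
  have hepos (v : H.neighbors z) : e v ≠ 0 := by
    simp only [e]
    split_ifs
    exacts [(H.weight_pos v).ne', one_ne_zero]
  let Q : Ideal (MvPolynomial (H.neighbors z) K) := Ideal.span (Set.range fun v ↦ X v ^ e v)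
  let x : H.neighbors z → MvPolynomial (H.neighbors z) K ⧸ Q := fun v ↦ Ideal.Quotient.mk Q (X v)
  have hx (v : H.neighbors z) : x v ^ e v = 0 := by
    rw [← map_pow]
    exact Ideal.Quotient.eq_zero_iff_mem.2 (Ideal.subset_span ⟨v, rfl⟩)
  have hx0 (v : H.neighbors z) (hv : ¬ H.Adj z v) : x v = 0 := by
    have := hx v
    rwa [show e v = 1 from if_neg hv, pow_one] at this
  let aug : (MvPolynomial (H.neighbors z) K ⧸ Q) →ₐ[K] K :=
    Ideal.Quotient.liftₐ Q (aeval fun _ ↦ (0 : K))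
      (map_eq_zero_of_mem_span_pow _ fun v ↦ by simp [hepos])
  have haug : RingHom.ker aug ≤ nilradical (MvPolynomial (H.neighbors z) K ⧸ Q) := by
    intro l hl
    have key : Ideal.Quotient.mkₐ K (nilradical (MvPolynomial (H.neighbors z) K ⧸ Q)) =
        (Algebra.ofId K _).comp aug := by
      refine Ideal.Quotient.algHom_ext _ (algHom_ext fun v ↦ ?_)
      have : x v ∈ nilradical _ := mem_nilradical.2 ⟨_, hx v⟩
      have haug : aug (x v) = 0 := (Ideal.Quotient.lift_mk _ _ _).trans (aeval_X _ _)
      refine (Ideal.Quotient.eq_zero_iff_mem.2 this).trans ?_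
      change 0 = Algebra.ofId K _ (aug (x v))
      rw [haug, map_zero]
    have hl' : aug l = 0 := hl
    have := DFunLike.congr_fun key l
    rw [AlgHom.comp_apply, hl', map_zero] at this
    exact Ideal.Quotient.eq_zero_iff_mem.1 this
  have hcol (v : H.neighbors z) : (X v.1 ^ e v : MvPolynomial V K) ∈
      (H.edgeIdeal K).colon {(X z : MvPolynomial V K) ^ 1} := by
    rw [Submodule.mem_colon_singleton, smul_eq_mul, pow_one]
    by_cases hv : H.Adj z v
    · simpa [e, hv, mul_comm] using mem_edgeIdeal (K := K) hv
    · have hv' := (mem_neighbors_iff.1 v.2).resolve_left hv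
      simpa [e, hv, hw] using mem_edgeIdeal (K := K) hv'
  let σΛ : (MvPolynomial (H.neighbors z) K ⧸ Q) →ₐ[K]
      MvPolynomial V K ⧸ (H.edgeIdeal K).colon {(X z : MvPolynomial V K) ^ 1} :=
    Ideal.Quotient.liftₐ Q (aeval fun v ↦ Ideal.Quotient.mk _ (X v.1)) <|
      map_eq_zero_of_mem_span_pow _ fun v ↦ by
        rw [aeval_X, ← map_pow]
        exact Ideal.Quotient.eq_zero_iff_mem.2 (hcol v)
  refine (hCM.tensorProduct_of_generators hS h (fun v ↦ Ideal.Quotient.mk _ (X v))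
    (adjoin_range_mk_X ((H.delete S).edgeIdeal K)) ?_ x (adjoin_range_mk_X Q) ?_ hx0
    (H.deleteMap S (le_colon_singleton _ _)) (deleteMap_mk_X _ _ _) σΛ
    fun v ↦ (Ideal.Quotient.lift_mk _ _ _).trans (aeval_X _ _)).of_tensorProduct aug haug
  · intro u v huv
    rw [← map_pow, ← map_mul]
    exact Ideal.Quotient.eq_zero_iff_mem.2 (mem_edgeIdeal (D := H.delete S) huv)
  · intro v
    by_cases hv : H.Adj z v
    · have := hx v
      rwa [show e v = H.weight v from if_pos hv] at this
    · rw [hx0 v hv, zero_pow (H.weight_pos v).ne']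

end WeightedOrientedGraph

theorem proposition3p4 {K : Type*} [Field K] {V : Type*} [Finite V]
    (H : WeightedOrientedGraph V) (z y : V)
    (hzy : y ∈ H.neighbors z)
    (hz : 2 ≤ H.degree z) (hy : H.degree y = 1)
    (hw : H.weight z = 1)
    (hCM : H.CohenMacaulay K) :
    (H.delete {z, y}).CohenMacaulay K ∧
      ((∀ x v : V, H.Adj z x → x ≠ y → v ∉ {z, y} ∪ H.neighbors z →
          v ∈ H.neighbors x → H.Adj v x) →
        (H.delete ({z, y} ∪ H.neighbors z)).CohenMacaulay K) := by
  have hyz : H.neighbors y = {z} := by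
    obtain ⟨u, hu⟩ := Set.ncard_eq_one.1 hy
    have hz : z ∈ H.neighbors y :=
      WeightedOrientedGraph.mem_neighbors_iff.2 (WeightedOrientedGraph.mem_neighbors_iff.1 hzy).symm
    rw [hu] at hz ⊢
    rw [Set.mem_singleton_iff.1 hz]
  refine ⟨hCM.delete_pendant hyz hw, fun h ↦ hCM.delete_neighbors ?_ hw ?_⟩
  · ext v
    simp only [Set.mem_union, Set.mem_insert_iff, Set.mem_singleton_iff]
    constructor
    · rintro ((h | rfl) | h)
      exacts [.inl h, .inr hzy, .inr h]
    · rintro (h | h)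
      exacts [.inl (.inl h), .inr h]
  · intro x v hzx hv hxv
    have hxv' := WeightedOrientedGraph.mem_neighbors_iff.2 (.inl hxv)
    -- The orientation hypothesis omits `y`, whose only neighbour `z` is deleted anyway.
    by_cases hxy : x = y
    · rw [hxy, hyz] at hxv'
      exact hv (.inl (.inl hxv'))
    · exact H.asymm _ _ hxv (h x v hzx hxy hv hxv')
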